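/- **Setting.** Formulas $\varphi$ of Gödel temporal logic are built from a countably infinite set of propositional variables with $\wedge,\vee,\Rightarrow$, co-implication $\Leftarrow$, $\mathsf X$ (next), $\mathsf Y$ (yesterday), $\mathsf G$ (always in the future), $\mathsf H$ (always in the past), $\mathbin{\mathsf U}$ (until) and $\mathbin{\mathsf S}$ (since). *Falsifiability.* A flow is a set $T$ with a bijection $S\colon T\to T$. A real valuation $V$ assigns to each formula and each $t\in T$ a value in $[0,1]$, where $\wedge,\vee$ are $\min,\max$; $V(\varphi\Rightarrow\psi,t)$ is $1$ if $V(\varphi,t)\le V(\psi,t)$ and $V(\psi,t)$ otherwise; $V(\varphi\Leftarrow\psi,t)$ is $0$ if $V(\varphi,t)\le V(\psi,t)$ and $V(\varphi,t)$ otherwise; $V(\mathsf X\varphi,t)=V(\varphi,S(t))$; $V(\mathsf G\varphi,t)=\inf_{n\ge 0}V(\varphi,S^n(t))$; $V(\varphi\mathbin{\mathsf U}\psi,t)=\sup_{n\ge0}\min\{V(\varphi,S^0(t)),\dots,V(\varphi,S^{n-1}(t)),V(\psi,S^n(t))\}$; and $\mathsf Y,\mathsf H,\mathbin{\mathsf S}$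 are interpreted likewise with $S^{-1}$ in place of $S$. A bi-relational model consists of a linear order $(W,\le)$, a flow $(T,S)$ and a set $[\![\varphi]\!]\subseteq W\times T$ for each formula, where $[\![p]\!]$ is downward closed in the first coordinate for each variable $p$; $\wedge,\vee$ are $\cap,\cup$; $(w,t)\in[\![\varphi\Rightarrow\psi]\!]$ iff for all $v\le w$, $(v,t)\in[\![\varphi]\!]$ implies $(v,t)\in[\![\psi]\!]$; $(w,t)\in[\![\varphi\Leftarrow\psi]\!]$ iff there is $v\ge w$ with $(v,t)\in[\![\varphi]\!]$ and $(v,t)\notin[\![\psi]\!]$; and the temporal connectives are read classically along $t\mapsto S(t)$ with $w$ fixed ($\mathsf G,\mathsf H,\mathbin{\mathsf U},\mathbin{\mathsf S}$ including the present). A formula $\varphi$ is *falsifiable* if some real valuation on some flow gives it a value $<1$ at some point, or if $[\![\varphi]\!]\ne W\times T$ in some bi-relational model. *Quasimodels.* Let $\Sigma$ be a set of formulas closed under subformulas. A *$\Sigma$-type* is a set $\Phi\subseteq\Sigma$ such that, for the indicated compound formulas in $\Sigma$: $\varphi\wedge\psi\in\Phi$ iff $\varphi\in\Phi$ and $\psi\in\Phi$;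 $\varphi\vee\psi\in\Phi$ iff $\varphi\in\Phi$ or $\psi\in\Phi$; $\varphi\Rightarrow\psi\in\Phi$ implies $\varphi\notin\Phi$ or $\psi\in\Phi$; $\psi\in\Phi$ implies $\varphi\Rightarrow\psi\in\Phi$; $\varphi\Leftarrow\psi\in\Phi$ implies $\varphi\in\Phi$; and $\varphi\in\Phi$, $\psi\notin\Phi$ imply $\varphi\Leftarrow\psi\in\Phi$. A *$\Sigma$-labelled space* $(W,\le,\ell)$ is a poset that is a disjoint union of linear posets, with a $\Sigma$-type $\ell(w)$ for each $w\in W$, such that $w\le v$ implies $\ell(w)\supseteq\ell(v)$; whenever $\varphi\Rightarrow\psi\in\Sigma\setminus\ell(w)$ there is $v\le w$ with $\varphi\in\ell(v)$, $\psi\notin\ell(v)$; and whenever $\varphi\Leftarrow\psi\in\ell(w)$ there is $v\ge w$ with $\varphi\in\ell(v)$, $\psi\notin\ell(v)$. It *falsifies* $\varphi$ if $\varphi\in\Sigma\setminus\ell(w)$ for some $w$. Its *height* is the supremum of all $n$ for which there is a chain $w_1<\dots<w_n$. The *linear component* of $w$ is $\{v : v\le w\text{ or }w\le v\}$. A *$\Sigma$-quasimodel*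 $(W,\le,\ell,R)$ is a $\Sigma$-labelled space with a relation $R\subseteq W\times W$ such that: - every $w$ has an $R$-successor and an $R$-predecessor; - for each $w$, the sets $\{v: w\mathrel R v\}$ and $\{v: v\mathrel R w\}$ are convex in $(W,\le)$ (i.e. contain $b$ whenever they contain $a,c$ with $a\le b\le c$); - $R$ is fully confluent: if $x\le x'\mathrel R y'$ there is $y$ with $x\mathrel R y\le y'$; if $x'\ge x\mathrel R y$ there is $y'$ with $x'\mathrel R y'\ge y$; if $x'\mathrel R y'\ge y$ there is $x$ with $x'\ge x\mathrel R y$; if $x\mathrel R y\le y'$ there is $x'$ with $x\le x'\mathrel R y'$; - $R$ is sensible: whenever $w\mathrel R v$, for the indicated compound formulas in $\Sigma$, $\mathsf X\varphi\in\ell(w)$ iff $\varphi\in\ell(v)$; $\mathsf Y\varphi\in\ell(v)$ iff $\varphi\in\ell(w)$; $\mathsf G\varphi\in\ell(w)$ iff $\varphi\in\ell(w)$ and $\mathsf G\varphi\in\ell(v)$; $\mathsf H\varphi\in\ell(v)$ iff $\varphi\in\ell(v)$ and $\mathsf H\varphi\in\ell(w)$; $\varphi\mathbin{\mathsf U}\psi\in\ell(w)$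 iff $\psi\in\ell(w)$ or ($\varphi\in\ell(w)$ and $\varphi\mathbin{\mathsf U}\psi\in\ell(v)$); $\varphi\mathbin{\mathsf S}\psi\in\ell(v)$ iff $\psi\in\ell(v)$ or ($\varphi\in\ell(v)$ and $\varphi\mathbin{\mathsf S}\psi\in\ell(w)$); - $R$ is $\omega$-sensible: whenever $\mathsf G\varphi\in\Sigma\setminus\ell(w)$ (resp. $\mathsf H\varphi\in\Sigma\setminus\ell(w)$) there are $n\ge0$ and $v$ with $w\mathrel{R^n}v$ (resp. $v\mathrel{R^n}w$) and $\varphi\in\Sigma\setminus\ell(v)$; whenever $\varphi\mathbin{\mathsf U}\psi\in\ell(w)$ (resp. $\varphi\mathbin{\mathsf S}\psi\in\ell(w)$) there are $n\ge0$ and $v$ with $w\mathrel{R^n}v$ (resp. $v\mathrel{R^n}w$) and $\psi\in\ell(v)$. *Ultimate periodicity.* A quasimodel $(W,\le,\ell,R)$ is *ultimately periodic* if there are integers $i',l',i,l\ge1$ and a map $\pi\colon W\to T=\{-(i'+l'-1),\dots,i+l-1\}$ such that each fibre $\pi^{-1}(t)$, $t\in T$, is an entire linear component of $W$, and $w\mathrel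 R v$ implies that $(\pi(w),\pi(v))$ is an edge of the "double lasso" on $T$, whose edges are $k\to k+1$ for $-(i'+l'-1)\le k\le i+l-2$, together with $i+l-1\to i$ and $-i'\to-(i'+l'-1)$. (So $T$ consists of a past loop, a middle segment containing $0$, and a future loop.) **Theorem (ultimately periodic quasimodel property).** Let $\varphi$ be a falsifiable formula and let $\Sigma$ be a finite set of formulas that is closed under subformulas and contains $\varphi$ (for example, the set of subformulas of $\varphi$). Then there is an ultimately periodic $\Sigma$-quasimodel of height at most $|\Sigma|+1$ that falsifies $\varphi$. -/

import Mathlib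

namespace GTL

/-- Formulas of Gödel temporal logic over the countably infinite set `ℕ` of propositional
variables. -/
inductive Formula : Type where
  /-- a propositional variable -/
  | var (p : ℕ) : Formula
  /-- conjunction -/
  | and (φ ψ : Formula) : Formula
  /-- disjunction -/
  | or (φ ψ : Formula) : Formula
  /-- implication `φ ⇒ ψ` -/
  | imp (φ ψ : Formula) : Formula
  /-- co-implication `φ ⇐ ψ`, the operator dual to implication -/
  | coimp (φ ψ : Formula) : Formula
  /-- `X φ`, next -/
  | next (φ : Formula) : Formula
  /-- `Y φ`, yesterday -/
  | yest (φ : Formula) : Formula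
  /-- `G φ`, going to always be -/
  | glob (φ : Formula) : Formula
  /-- `H φ`, has always been -/
  | hist (φ : Formula) : Formula
  /-- `φ U ψ`, until -/
  | untl (φ ψ : Formula) : Formula
  /-- `φ S ψ`, since -/
  | snce (φ ψ : Formula) : Formula

/-- The set of subformulas of a formula (the formula itself included). -/
def Formula.subformulas : Formula → Set Formula
  | .var p => {.var p}
  | .and φ ψ => insert (.and φ ψ) (φ.subformulas ∪ ψ.subformulas)
  | .or φ ψ => insert (.or φ ψ) (φ.subformulas ∪ ψ.subformulas)
  | .imp φ ψ => insert (.imp φ ψ) (φ.subformulas ∪ ψ.subformulas)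
  | .coimp φ ψ => insert (.coimp φ ψ) (φ.subformulas ∪ ψ.subformulas)
  | .next φ => insert (.next φ) φ.subformulas
  | .yest φ => insert (.yest φ) φ.subformulas
  | .glob φ => insert (.glob φ) φ.subformulas
  | .hist φ => insert (.hist φ) φ.subformulas
  | .untl φ ψ => insert (.untl φ ψ) (φ.subformulas ∪ ψ.subformulas)
  | .snce φ ψ => insert (.snce φ ψ) (φ.subformulas ∪ ψ.subformulas)

/-- `Sig` is closed under subformulas. -/
def SubformulaClosed (Sig : Set Formula) : Prop :=
  ∀ φ ∈ Sig, φ.subformulas ⊆ Sig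

/-! ### Real-valued semantics -/

/-- `V` is a real valuation on the flow `(T, S)`, where `S` is a bijection of `T`. Infima and
suprema are taken in the real unit interval. -/
structure IsRealValuation {T : Type*} (S : Equiv.Perm T) (V : Formula → T → unitInterval) :
    Prop where
  and : ∀ φ ψ t, V (.and φ ψ) t = min (V φ t) (V ψ t)
  or : ∀ φ ψ t, V (.or φ ψ) t = max (V φ t) (V ψ t)
  imp : ∀ φ ψ t, V (.imp φ ψ) t = if V φ t ≤ V ψ t then 1 else V ψ t
  coimp : ∀ φ ψ t, V (.coimp φ ψ) t = if V φ t ≤ V ψ t then 0 else V φ t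
  next : ∀ φ t, V (.next φ) t = V φ (S t)
  yest : ∀ φ t, V (.yest φ) t = V φ (S⁻¹ t)
  glob : ∀ φ t, IsGLB (Set.range fun n : ℕ => V φ ((S ^ n) t)) (V (.glob φ) t)
  hist : ∀ φ t, IsGLB (Set.range fun n : ℕ => V φ ((S⁻¹ ^ n) t)) (V (.hist φ) t)
  untl : ∀ φ ψ t, IsLUB
    (Set.range fun n : ℕ =>
      min ((Finset.range n).inf fun k => V φ ((S ^ k) t)) (V ψ ((S ^ n) t)))
    (V (.untl φ ψ) t)
  snce : ∀ φ ψ t, IsLUB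
    (Set.range fun n : ℕ =>
      min ((Finset.range n).inf fun k => V φ ((S⁻¹ ^ k) t)) (V ψ ((S⁻¹ ^ n) t)))
    (V (.snce φ ψ) t)

/-- Validity over the class of all flows. -/
def RealValid.{u} (φ : Formula) : Prop :=
  ∀ (T : Type u) (S : Equiv.Perm T) (V : Formula → T → unitInterval),
    IsRealValuation S V → ∀ t, V φ t = 1

/-! ### Bi-relational semantics -/

/-- `val` is a bi-relational valuation on the frame `(W, T, ≤, S)`, where `(W, ≤)` is linearly
ordered and `S` is a bijection of `T`. -/
structure IsBiRelValuation {W T : Type*} [LinearOrder W] (S : Equiv.Perm T)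
    (val : Formula → Set (W × T)) : Prop where
  var : ∀ p w v t, v ≤ w → (w, t) ∈ val (.var p) → (v, t) ∈ val (.var p)
  and : ∀ φ ψ, val (.and φ ψ) = val φ ∩ val ψ
  or : ∀ φ ψ, val (.or φ ψ) = val φ ∪ val ψ
  imp : ∀ φ ψ w t, (w, t) ∈ val (.imp φ ψ) ↔ ∀ v ≤ w, (v, t) ∈ val φ → (v, t) ∈ val ψ
  coimp : ∀ φ ψ w t, (w, t) ∈ val (.coimp φ ψ) ↔ ∃ v ≥ w, (v, t) ∈ val φ ∧ (v, t) ∉ val ψ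
  next : ∀ φ w t, (w, t) ∈ val (.next φ) ↔ (w, S t) ∈ val φ
  yest : ∀ φ w t, (w, t) ∈ val (.yest φ) ↔ (w, S⁻¹ t) ∈ val φ
  glob : ∀ φ w t, (w, t) ∈ val (.glob φ) ↔ ∀ n : ℕ, (w, (S ^ n) t) ∈ val φ
  hist : ∀ φ w t, (w, t) ∈ val (.hist φ) ↔ ∀ n : ℕ, (w, (S⁻¹ ^ n) t) ∈ val φ
  untl : ∀ φ ψ w t, (w, t) ∈ val (.untl φ ψ) ↔
    ∃ n : ℕ, (∀ k < n, (w, (S ^ k) t) ∈ val φ) ∧ (w, (S ^ n) t) ∈ val ψ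
  snce : ∀ φ ψ w t, (w, t) ∈ val (.snce φ ψ) ↔
    ∃ n : ℕ, (∀ k < n, (w, (S⁻¹ ^ k) t) ∈ val φ) ∧ (w, (S⁻¹ ^ n) t) ∈ val ψ

/-- Validity over the class of all bi-relational frames. -/
def BiRelValid.{u, v} (φ : Formula) : Prop :=
  ∀ (W : Type u) (T : Type v) [LinearOrder W] (S : Equiv.Perm T) (val : Formula → Set (W × T)),
    IsBiRelValuation S val → val φ = Set.univ

/-! ### Types, labelled spaces, quasimodels -/

/-- `Φ` is a `Sig`-type. -/
structure IsSigType (Sig Φ : Set Formula) : Prop where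
  subset : Φ ⊆ Sig
  and : ∀ φ ψ, .and φ ψ ∈ Sig → (.and φ ψ ∈ Φ ↔ φ ∈ Φ ∧ ψ ∈ Φ)
  or : ∀ φ ψ, .or φ ψ ∈ Sig → (.or φ ψ ∈ Φ ↔ φ ∈ Φ ∨ ψ ∈ Φ)
  imp_elim : ∀ φ ψ, .imp φ ψ ∈ Sig → .imp φ ψ ∈ Φ → φ ∉ Φ ∨ ψ ∈ Φ
  imp_intro : ∀ φ ψ, .imp φ ψ ∈ Sig → ψ ∈ Φ → .imp φ ψ ∈ Φ
  coimp_elim : ∀ φ ψ, .coimp φ ψ ∈ Sig → .coimp φ ψ ∈ Φ → φ ∈ Φ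
  coimp_intro : ∀ φ ψ, .coimp φ ψ ∈ Sig → φ ∈ Φ → ψ ∉ Φ → .coimp φ ψ ∈ Φ

/-- A poset is locally linear if it is a disjoint union of linear posets: it can be partitioned
so that two elements lie in the same block exactly when they are comparable. -/
def LocallyLinear (A : Type*) [PartialOrder A] : Prop :=
  ∃ r : Setoid A, ∀ a b : A, r a b ↔ a ≤ b ∨ b ≤ a

/-- The linear component of `a`. -/
def linearComponent {A : Type*} [PartialOrder A] (a : A) : Set A :=
  {b | a ≤ b ∨ b ≤ a}

/-- `(W, ≤, l)` is a `Sig`-labelled space. -/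
structure IsLabelledSpace {W : Type*} [PartialOrder W] (Sig : Set Formula)
    (l : W → Set Formula) : Prop where
  locallyLinear : LocallyLinear W
  isType : ∀ w, IsSigType Sig (l w)
  antitone : ∀ w v, w ≤ v → l v ⊆ l w
  imp : ∀ w φ ψ, .imp φ ψ ∈ Sig \ l w → ∃ v ≤ w, φ ∈ l v ∧ ψ ∉ l v
  coimp : ∀ w φ ψ, .coimp φ ψ ∈ l w → ∃ v ≥ w, φ ∈ l v ∧ ψ ∉ l v

/-- The labelled space `(W, l)` falsifies `φ`. -/
def Falsifies {W : Type*} (Sig : Set Formula) (l : W → Set Formula) (φ : Formula) : Prop :=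
  ∃ w, φ ∈ Sig \ l w

/-- The height of a poset: the supremum of all `n` such that there is a chain
`w₁ < w₂ < ⋯ < wₙ`. -/
noncomputable def height (W : Type*) [PartialOrder W] : ℕ∞ :=
  ⨆ (n : ℕ) (_ : ∃ w : Fin n → W, StrictMono w), (n : ℕ∞)

/-- Convex relation: all image sets and all preimage sets are convex in the order sense. -/
def ConvexRel {A B : Type*} [PartialOrder A] [PartialOrder B] (R : A → B → Prop) : Prop :=
  (∀ x, Set.OrdConnected {y | R x y}) ∧ (∀ y, Set.OrdConnected {x | R x y})

/-- The four confluence conditions. -/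
structure FullyConfluent {A B : Type*} [PartialOrder A] [PartialOrder B] (R : A → B → Prop) :
    Prop where
  forth_down : ∀ x x' y', x ≤ x' → R x' y' → ∃ y, R x y ∧ y ≤ y'
  forth_up : ∀ x x' y, x ≤ x' → R x y → ∃ y', R x' y' ∧ y ≤ y'
  back_down : ∀ x' y y', R x' y' → y ≤ y' → ∃ x, x ≤ x' ∧ R x y
  back_up : ∀ x y y', R x y → y ≤ y' → ∃ x', x ≤ x' ∧ R x' y'

/-- The ordered pair `(Φ, Ψ)` of `Sig`-types is sensible. -/
structure SensiblePair (Sig Φ Ψ : Set Formula) : Prop where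
  next : ∀ φ, .next φ ∈ Sig → (.next φ ∈ Φ ↔ φ ∈ Ψ)
  yest : ∀ φ, .yest φ ∈ Sig → (.yest φ ∈ Ψ ↔ φ ∈ Φ)
  glob : ∀ φ, .glob φ ∈ Sig → (.glob φ ∈ Φ ↔ φ ∈ Φ ∧ .glob φ ∈ Ψ)
  hist : ∀ φ, .hist φ ∈ Sig → (.hist φ ∈ Ψ ↔ φ ∈ Ψ ∧ .hist φ ∈ Φ)
  untl : ∀ φ ψ, .untl φ ψ ∈ Sig → (.untl φ ψ ∈ Φ ↔ ψ ∈ Φ ∨ (φ ∈ Φ ∧ .untl φ ψ ∈ Ψ))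
  snce : ∀ φ ψ, .snce φ ψ ∈ Sig → (.snce φ ψ ∈ Ψ ↔ ψ ∈ Ψ ∨ (φ ∈ Ψ ∧ .snce φ ψ ∈ Φ))

/-- `R` is `ω`-sensible. The existence of an `n ≥ 0` with `w Rⁿ v` is expressed by the
reflexive transitive closure of `R`. -/
structure OmegaSensible {W : Type*} (Sig : Set Formula) (l : W → Set Formula)
    (R : W → W → Prop) : Prop where
  glob : ∀ w φ, .glob φ ∈ Sig \ l w → ∃ v, Relation.ReflTransGen R w v ∧ φ ∈ Sig \ l v
  hist : ∀ w φ, .hist φ ∈ Sig \ l w → ∃ v, Relation.ReflTransGen R v w ∧ φ ∈ Sig \ l v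
  untl : ∀ w φ ψ, .untl φ ψ ∈ l w → ∃ v, Relation.ReflTransGen R w v ∧ ψ ∈ l v
  snce : ∀ w φ ψ, .snce φ ψ ∈ l w → ∃ v, Relation.ReflTransGen R v w ∧ ψ ∈ l v

/-- `(W, ≤, l, R)` is a `Sig`-labelled system. -/
structure IsLabelledSystem {W : Type*} [PartialOrder W] (Sig : Set Formula)
    (l : W → Set Formula) (R : W → W → Prop) : Prop extends IsLabelledSpace Sig l where
  serial : ∀ w, ∃ v, R w v
  serial_back : ∀ w, ∃ v, R v w
  confluent : FullyConfluent R
  convex : ConvexRel R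
  sensible : ∀ w v, R w v → SensiblePair Sig (l w) (l v)

/-- `(W, ≤, l, R)` is a `Sig`-quasimodel. -/
structure IsQuasimodel {W : Type*} [PartialOrder W] (Sig : Set Formula)
    (l : W → Set Formula) (R : W → W → Prop) : Prop extends IsLabelledSystem Sig l R where
  omega : OmegaSensible Sig l R

/-! ### Ultimately periodic quasimodels -/

/-- The vertex set `{-(i' + l' - 1), …, i + l - 1}` of the double lasso. -/
def lassoVertices (i' l' i l : ℕ) : Set ℤ :=
  Set.Icc (-((i' : ℤ) + l' - 1)) ((i : ℤ) + l - 1)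

/-- The edges of the double lasso: each vertex has an edge to the next one, the last vertex
`i + l - 1` has an edge back to `i`, and `-i'` has an edge back to the first vertex
`-(i' + l' - 1)`. -/
def LassoEdge (i' l' i l : ℕ) (a b : ℤ) : Prop :=
  (-((i' : ℤ) + l' - 1) ≤ a ∧ a ≤ (i : ℤ) + l - 2 ∧ b = a + 1) ∨
  (a = (i : ℤ) + l - 1 ∧ b = i) ∨
  (a = -(i' : ℤ) ∧ b = -((i' : ℤ) + l' - 1))

/-- The relation `R` on the locally linear poset `W` is ultimately periodic: `W` projects to a
double lasso consisting of a past loop `-(i' + l' - 1), …, -i'`, a middle segment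
containing `0`, and a future loop `i, …, i + l - 1`; every fibre is an entire linear component
of `W`, and `R` projects to the edges of the double lasso. -/
def UltimatelyPeriodic {W : Type*} [PartialOrder W] (R : W → W → Prop) : Prop :=
  ∃ i' l' i l : ℕ, 0 < i' ∧ 0 < l' ∧ 0 < i ∧ 0 < l ∧
    ∃ π : W → ℤ,
      (∀ w, π w ∈ lassoVertices i' l' i l) ∧
      (∀ t ∈ lassoVertices i' l' i l, ∃ w, π ⁻¹' {t} = linearComponent w) ∧
      (∀ w v, R w v → LassoEdge i' l' i l (π w) (π v))

end GTL

universe u v w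

namespace GTL

/-! Restricting a countermodel to the orbit of one point turns time into `ℤ` and yields a trace:
each degree `w` of a linear order carries a type `τ w k` at every time `k`, and types shrink as the
degree grows. In the real case the degrees are the cut-offs in `(0,1]`. A supremum defining `U` or
`S` need not be attained, so an eventuality holding at `w` may be realised only at lower degrees.
Since `Sig` is finite, a slightly lower degree has the same type at time `k`; this is why traces may
change degree before realising an eventuality.

Only finitely many sets of types can occur at a time, so towards the future some set recurs
infinitely often (`exists_loop`). Closing the loop late enough leaves room to realise every
eventuality pending at its start. The past is treated by reversing time. Folding at both recurrences
gives a double lasso; its points are pairs of a vertex and a type occurring there, and an edge joins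
two types that a single degree has at consecutive times.

At each step the relation is the image of a linear order under a pair of antitone maps. This alone
gives confluence and convexity (the `coupling_*` lemmas). Eventualities are followed edge by edge to
the start of the loop and realised there along one degree (`reach_realised`). The types at a vertex
form a chain of subsets of `Sig`, which bounds the height. -/

/-- A family of `Sig`-types indexed by a linear order of truth degrees and by discrete time, in
which eventualities are realised, up to replacing a degree by one with the same current type. -/
structure IsTrace {L : Type*} [LinearOrder L] (Sig : Set Formula) (τ : L → ℤ → Set Formula) :
    Prop where
  isType : ∀ w k, IsSigType Sig (τ w k)
  antitone : ∀ k, Antitone fun w => τ w k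
  imp : ∀ w k φ ψ, .imp φ ψ ∈ Sig \ τ w k → ∃ v ≤ w, φ ∈ τ v k ∧ ψ ∉ τ v k
  coimp : ∀ w k φ ψ, .coimp φ ψ ∈ τ w k → ∃ v ≥ w, φ ∈ τ v k ∧ ψ ∉ τ v k
  sensible : ∀ w k, SensiblePair Sig (τ w k) (τ w (k + 1))
  glob : ∀ w k φ, .glob φ ∈ Sig \ τ w k → ∃ v, τ v k = τ w k ∧ ∃ n : ℕ, φ ∉ τ v (k + n)
  hist : ∀ w k φ, .hist φ ∈ Sig \ τ w k → ∃ v, τ v k = τ w k ∧ ∃ n : ℕ, φ ∉ τ v (k - n)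
  untl : ∀ w k φ ψ, .untl φ ψ ∈ τ w k → ∃ v, τ v k = τ w k ∧ ∃ n : ℕ, ψ ∈ τ v (k + n)
  snce : ∀ w k φ ψ, .snce φ ψ ∈ τ w k → ∃ v, τ v k = τ w k ∧ ∃ n : ℕ, ψ ∈ τ v (k - n)

theorem Formula.self_mem_subformulas (φ : Formula) : φ ∈ φ.subformulas := by
  cases φ <;> simp [Formula.subformulas]

/-! ### Subformula closure and orbits of a flow. -/

section Closure

variable {Sig : Set Formula} {φ ψ : Formula}

theorem SubformulaClosed.and (h : SubformulaClosed Sig) (hm : .and φ ψ ∈ Sig) :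
    φ ∈ Sig ∧ ψ ∈ Sig :=
  ⟨h _ hm (by simp [Formula.subformulas, φ.self_mem_subformulas]),
    h _ hm (by simp [Formula.subformulas, ψ.self_mem_subformulas])⟩

theorem SubformulaClosed.or (h : SubformulaClosed Sig) (hm : .or φ ψ ∈ Sig) :
    φ ∈ Sig ∧ ψ ∈ Sig :=
  ⟨h _ hm (by simp [Formula.subformulas, φ.self_mem_subformulas]),
    h _ hm (by simp [Formula.subformulas, ψ.self_mem_subformulas])⟩

theorem SubformulaClosed.imp (h : SubformulaClosed Sig) (hm : .imp φ ψ ∈ Sig) :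
    φ ∈ Sig ∧ ψ ∈ Sig :=
  ⟨h _ hm (by simp [Formula.subformulas, φ.self_mem_subformulas]),
    h _ hm (by simp [Formula.subformulas, ψ.self_mem_subformulas])⟩

theorem SubformulaClosed.coimp (h : SubformulaClosed Sig) (hm : .coimp φ ψ ∈ Sig) :
    φ ∈ Sig ∧ ψ ∈ Sig :=
  ⟨h _ hm (by simp [Formula.subformulas, φ.self_mem_subformulas]),
    h _ hm (by simp [Formula.subformulas, ψ.self_mem_subformulas])⟩

theorem SubformulaClosed.untl (h : SubformulaClosed Sig) (hm : .untl φ ψ ∈ Sig) :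
    φ ∈ Sig ∧ ψ ∈ Sig :=
  ⟨h _ hm (by simp [Formula.subformulas, φ.self_mem_subformulas]),
    h _ hm (by simp [Formula.subformulas, ψ.self_mem_subformulas])⟩

theorem SubformulaClosed.snce (h : SubformulaClosed Sig) (hm : .snce φ ψ ∈ Sig) :
    φ ∈ Sig ∧ ψ ∈ Sig :=
  ⟨h _ hm (by simp [Formula.subformulas, φ.self_mem_subformulas]),
    h _ hm (by simp [Formula.subformulas, ψ.self_mem_subformulas])⟩

theorem SubformulaClosed.next (h : SubformulaClosed Sig) (hm : .next φ ∈ Sig) : φ ∈ Sig :=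
  h _ hm (by simp [Formula.subformulas, φ.self_mem_subformulas])

theorem SubformulaClosed.yest (h : SubformulaClosed Sig) (hm : .yest φ ∈ Sig) : φ ∈ Sig :=
  h _ hm (by simp [Formula.subformulas, φ.self_mem_subformulas])

theorem SubformulaClosed.glob (h : SubformulaClosed Sig) (hm : .glob φ ∈ Sig) : φ ∈ Sig :=
  h _ hm (by simp [Formula.subformulas, φ.self_mem_subformulas])

theorem SubformulaClosed.hist (h : SubformulaClosed Sig) (hm : .hist φ ∈ Sig) : φ ∈ Sig :=
  h _ hm (by simp [Formula.subformulas, φ.self_mem_subformulas])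

end Closure

section Orbit

variable {T : Type*} (S : Equiv.Perm T) (t : T) (k : ℤ)

theorem apply_zpow_apply : S ((S ^ k) t) = (S ^ (k + 1)) t := by
  rw [add_comm, zpow_add, zpow_one, Equiv.Perm.mul_apply]

theorem inv_apply_zpow_apply : S⁻¹ ((S ^ k) t) = (S ^ (k - 1)) t := by
  rw [sub_eq_neg_add, zpow_add, zpow_neg_one, Equiv.Perm.mul_apply]

theorem pow_apply_zpow_apply (n : ℕ) : (S ^ n) ((S ^ k) t) = (S ^ (k + n)) t := by
  rw [add_comm, zpow_add, zpow_natCast, Equiv.Perm.mul_apply]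

theorem inv_pow_apply_zpow_apply (n : ℕ) : (S⁻¹ ^ n) ((S ^ k) t) = (S ^ (k - n)) t := by
  rw [sub_eq_neg_add, zpow_add, zpow_neg, zpow_natCast, Equiv.Perm.mul_apply, inv_pow]

end Orbit

/-- This equivalence and the next two are the one-step unfoldings of `G`, `H` and `U`/`S` that
`SensiblePair` asks for. -/
theorem forall_add_nat_iff {p : ℤ → Prop} {k : ℤ} :
    (∀ n : ℕ, p (k + n)) ↔ p k ∧ ∀ n : ℕ, p (k + 1 + n) := by
  refine ⟨fun h => ⟨by simpa using h 0, fun n => ?_⟩, fun h n => ?_⟩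
  · simpa [add_assoc, add_comm (1 : ℤ)] using h (n + 1)
  · cases n with
    | zero => simpa using h.1
    | succ n => simpa [add_assoc, add_comm (1 : ℤ)] using h.2 n

theorem forall_sub_nat_iff {p : ℤ → Prop} {k : ℤ} :
    (∀ n : ℕ, p (k + 1 - n)) ↔ p (k + 1) ∧ ∀ n : ℕ, p (k - n) := by
  refine ⟨fun h => ⟨by simpa using h 0, fun n => ?_⟩, fun h n => ?_⟩
  · simpa using h (n + 1)
  · cases n with
    | zero => simpa using h.1
    | succ n => simpa using h.2 n

theorem exists_until_iff {a b : ℕ → Prop} :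
    (∃ n, (∀ m < n, a m) ∧ b n) ↔
      b 0 ∨ (a 0 ∧ ∃ n, (∀ m < n, a (m + 1)) ∧ b (n + 1)) := by
  constructor
  · rintro ⟨_ | n, h, hb⟩
    · exact .inl hb
    · exact .inr ⟨h 0 n.succ_pos, n, fun m hm => h _ (by omega), hb⟩
  · rintro (hb | ⟨ha, n, h, hb⟩)
    · exact ⟨0, by simp, hb⟩
    · refine ⟨n + 1, fun m hm => ?_, hb⟩
      cases m with
      | zero => exact ha
      | succ m => exact h m (by omega)

/-! ### Traces from bi-relational models. -/

section BiRel

variable {W T : Type*} [LinearOrder W] {S : Equiv.Perm T} {val : Formula → Set (W × T)}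

theorem IsBiRelValuation.downward_closed (h : IsBiRelValuation S val) (φ : Formula) :
    ∀ {v w : W} (t : T), v ≤ w → (w, t) ∈ val φ → (v, t) ∈ val φ := by
  induction φ with
  | var p => exact fun t hvw hm => h.var p _ _ t hvw hm
  | and φ ψ ih₁ ih₂ =>
    intro v w t hvw hm
    rw [h.and] at hm ⊢
    exact ⟨ih₁ t hvw hm.1, ih₂ t hvw hm.2⟩
  | or φ ψ ih₁ ih₂ =>
    intro v w t hvw hm
    rw [h.or] at hm ⊢
    exact hm.imp (ih₁ t hvw) (ih₂ t hvw)
  | imp φ ψ =>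
    intro v w t hvw hm
    rw [h.imp] at hm ⊢
    exact fun u hu => hm u (hu.trans hvw)
  | coimp φ ψ =>
    intro v w t hvw hm
    rw [h.coimp] at hm ⊢
    obtain ⟨u, hu, hm⟩ := hm
    exact ⟨u, hvw.trans hu, hm⟩
  | next φ ih =>
    intro v w t hvw hm
    rw [h.next] at hm ⊢
    exact ih _ hvw hm
  | yest φ ih =>
    intro v w t hvw hm
    rw [h.yest] at hm ⊢
    exact ih _ hvw hm
  | glob φ ih =>
    intro v w t hvw hm
    rw [h.glob] at hm ⊢
    exact fun n => ih _ hvw (hm n)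
  | hist φ ih =>
    intro v w t hvw hm
    rw [h.hist] at hm ⊢
    exact fun n => ih _ hvw (hm n)
  | untl φ ψ ih₁ ih₂ =>
    intro v w t hvw hm
    rw [h.untl] at hm ⊢
    obtain ⟨n, hn, hm⟩ := hm
    exact ⟨n, fun k hk => ih₁ _ hvw (hn k hk), ih₂ _ hvw hm⟩
  | snce φ ψ ih₁ ih₂ =>
    intro v w t hvw hm
    rw [h.snce] at hm ⊢
    obtain ⟨n, hn, hm⟩ := hm
    exact ⟨n, fun k hk => ih₁ _ hvw (hn k hk), ih₂ _ hvw hm⟩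

theorem IsBiRelValuation.isTrace (h : IsBiRelValuation S val) {Sig : Set Formula}
    (hsub : SubformulaClosed Sig) (t : T) :
    IsTrace Sig fun w k => {ψ ∈ Sig | (w, (S ^ k) t) ∈ val ψ} where
  isType w k :=
    { subset := fun ψ hψ => hψ.1
      and := fun φ ψ hm => by simp [h.and, hm, hsub.and hm]
      or := fun φ ψ hm => by simp [h.or, hm, hsub.or hm]
      imp_elim := fun φ ψ hm hi => by
        have := (h.imp _ _ _ _).1 hi.2 w le_rfl
        simp only [Set.mem_ofPred_eq, hsub.imp hm, true_and]
        tauto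
      imp_intro := fun φ ψ hm hi =>
        ⟨hm, (h.imp _ _ _ _).2 fun v hv _ => h.downward_closed ψ _ hv hi.2⟩
      coimp_elim := fun φ ψ hm hi => by
        obtain ⟨v, hv, hφ, -⟩ := (h.coimp _ _ _ _).1 hi.2
        exact ⟨(hsub.coimp hm).1, h.downward_closed φ _ hv hφ⟩
      coimp_intro := fun φ ψ hm hφ hψ =>
        ⟨hm, (h.coimp _ _ _ _).2 ⟨w, le_rfl, hφ.2, fun hn => hψ ⟨(hsub.coimp hm).2, hn⟩⟩⟩ }
  antitone k v w hvw ψ hψ := ⟨hψ.1, h.downward_closed ψ _ hvw hψ.2⟩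
  imp w k φ ψ hm := by
    have h1 : (w, (S ^ k) t) ∉ val (.imp φ ψ) := fun hn => hm.2 ⟨hm.1, hn⟩
    rw [h.imp] at h1
    push Not at h1
    obtain ⟨v, hv, hφ, hψ⟩ := h1
    exact ⟨v, hv, ⟨(hsub.imp hm.1).1, hφ⟩, fun hn => hψ hn.2⟩
  coimp w k φ ψ hm := by
    obtain ⟨v, hv, hφ, hψ⟩ := (h.coimp _ _ _ _).1 hm.2
    exact ⟨v, hv, ⟨(hsub.coimp hm.1).1, hφ⟩, fun hn => hψ hn.2⟩
  sensible w k :=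
    { next := fun φ hm => by
        simp [hm, hsub.next hm, h.next, apply_zpow_apply]
      yest := fun φ hm => by
        simp [hm, hsub.yest hm, h.yest, inv_apply_zpow_apply]
      glob := fun φ hm => by
        simp only [Set.mem_ofPred_eq, hm, hsub.glob hm, h.glob, pow_apply_zpow_apply, true_and]
        exact forall_add_nat_iff (p := fun m => (w, (S ^ m) t) ∈ val φ)
      hist := fun φ hm => by
        simp only [Set.mem_ofPred_eq, hm, hsub.hist hm, h.hist, inv_pow_apply_zpow_apply, true_and]
        exact forall_sub_nat_iff (p := fun m => (w, (S ^ m) t) ∈ val φ)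
      untl := fun φ ψ hm => by
        simp only [Set.mem_ofPred_eq, hm, hsub.untl hm, h.untl, pow_apply_zpow_apply, true_and]
        rw [exists_until_iff]
        simp [add_assoc, add_comm (1 : ℤ)]
      snce := fun φ ψ hm => by
        simp only [Set.mem_ofPred_eq, hm, hsub.snce hm, h.snce, inv_pow_apply_zpow_apply, true_and]
        rw [exists_until_iff]
        simp }
  glob w k φ hm := by
    have h1 : (w, (S ^ k) t) ∉ val (.glob φ) := fun hn => hm.2 ⟨hm.1, hn⟩
    simp only [h.glob, pow_apply_zpow_apply, not_forall] at h1
    obtain ⟨n, hn⟩ := h1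
    exact ⟨w, rfl, n, fun hn' => hn hn'.2⟩
  hist w k φ hm := by
    have h1 : (w, (S ^ k) t) ∉ val (.hist φ) := fun hn => hm.2 ⟨hm.1, hn⟩
    simp only [h.hist, inv_pow_apply_zpow_apply, not_forall] at h1
    obtain ⟨n, hn⟩ := h1
    exact ⟨w, rfl, n, fun hn' => hn hn'.2⟩
  untl w k φ ψ hm := by
    have h1 := hm.2
    simp only [h.untl, pow_apply_zpow_apply] at h1
    obtain ⟨n, -, hn⟩ := h1
    exact ⟨w, rfl, n, (hsub.untl hm.1).2, hn⟩
  snce w k φ ψ hm := by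
    have h1 := hm.2
    simp only [h.snce, inv_pow_apply_zpow_apply] at h1
    obtain ⟨n, -, hn⟩ := h1
    exact ⟨w, rfl, n, (hsub.snce hm.1).2, hn⟩

end BiRel

/-! ### Traces from real valuations. -/

section Real

/-- Take `v` above every element of `s` that lies below `w`. Lowering a cut-off from `w` to `v` then
changes no comparison with the values in `s`. -/
theorem Set.Finite.exists_between_gap {α : Type*} [LinearOrder α] [DenselyOrdered α] {s : Set α}
    (hs : s.Finite) {a w : α} (haw : a < w) :
    ∃ v, a < v ∧ v < w ∧ ∀ x ∈ s, v ≤ x → w ≤ x := by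
  induction s, hs using Set.Finite.induction_on with
  | empty =>
    obtain ⟨v, h₁, h₂⟩ := exists_between haw
    exact ⟨v, h₁, h₂, by simp⟩
  | @insert b s _ _ ih =>
    obtain ⟨v, h₁, h₂, h₃⟩ := ih
    by_cases hb : w ≤ b
    · exact ⟨v, h₁, h₂, by rintro x (rfl | hx) hv; exacts [hb, h₃ x hx hv]⟩
    · obtain ⟨u, hu₁, hu₂⟩ := exists_between (max_lt h₂ (not_le.1 hb))
      rw [max_lt_iff] at hu₁
      refine ⟨u, h₁.trans hu₁.1, hu₂, ?_⟩
      rintro x (rfl | hx) hv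
      · exact absurd hv (not_le.2 hu₁.2)
      · exact h₃ x hx (hu₁.1.le.trans hv)

/-- Strict lower bounds of a supremum are passed by a single member, so below the value, until
behaves as in classical semantics even when the supremum is not attained. -/
theorem lt_until_iff {a b : ℕ → unitInterval} {x c : unitInterval}
    (hx : IsLUB (Set.range fun n : ℕ => min ((Finset.range n).inf a) (b n)) x) :
    c < x ↔ ∃ n, (∀ m < n, c < a m) ∧ c < b n := by
  rw [lt_isLUB_iff hx]
  simp only [Set.exists_range_iff, lt_min_iff]
  refine exists_congr fun n => and_congr_left fun h => ?_
  -- For `n = 0` the infimum is over the empty set and equals `⊤`, so `c < ⊤` is needed; it follows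
  -- from `c < b n`.
  rw [Finset.lt_inf_iff (h.trans_le le_top)]
  simp

theorem until_eq {a b : ℕ → unitInterval} {x y : unitInterval}
    (hx : IsLUB (Set.range fun n : ℕ => min ((Finset.range n).inf a) (b n)) x)
    (hy : IsLUB (Set.range fun n : ℕ =>
      min ((Finset.range n).inf fun m => a (m + 1)) (b (n + 1))) y) :
    x = max (b 0) (min (a 0) y) := by
  refine eq_of_forall_lt_iff fun c => ?_
  rw [lt_until_iff hx, lt_max_iff, lt_min_iff,
    lt_until_iff (a := fun m => a (m + 1)) (b := fun m => b (m + 1)) hy]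
  exact exists_until_iff

variable {T : Type*} {S : Equiv.Perm T} {V : Formula → T → unitInterval}

/-- Degree `0` is excluded because every formula of `Sig` would belong to its type, including
co-implications of value `0`, which have no witness. -/
theorem IsRealValuation.isTrace (h : IsRealValuation S V) {Sig : Set Formula} (hfin : Sig.Finite)
    (hsub : SubformulaClosed Sig) (t : T) :
    IsTrace Sig fun (w : {x : unitInterval // 0 < x}) (k : ℤ) =>
      {ψ ∈ Sig | w.1 ≤ V ψ ((S ^ k) t)} := by
  have gap : ∀ (w : {x : unitInterval // 0 < x}) (k : ℤ), ∃ v : {x : unitInterval // 0 < x},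
      v < w ∧ {ψ ∈ Sig | v.1 ≤ V ψ ((S ^ k) t)} = {ψ ∈ Sig | w.1 ≤ V ψ ((S ^ k) t)} := by
    intro w k
    obtain ⟨v, hv₀, hv, hgap⟩ :=
      Set.Finite.exists_between_gap (hfin.image fun ψ => V ψ ((S ^ k) t)) w.2
    refine ⟨⟨v, hv₀⟩, hv, Set.ext fun ψ => and_congr_right fun hψ => ⟨fun hle => ?_, fun hle => ?_⟩⟩
    · exact hgap _ ⟨ψ, hψ, rfl⟩ hle
    · exact hv.le.trans hle
  refine
    { isType := fun w k =>
        { subset := fun ψ hψ => hψ.1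
          and := fun φ ψ hm => by simp [h.and, hm, hsub.and hm]
          or := fun φ ψ hm => by simp [h.or, hm, hsub.or hm]
          imp_elim := fun φ ψ hm hi => by
            have h1 := hi.2
            simp only [Set.mem_ofPred_eq, hsub.imp hm, true_and, not_le]
            rw [h.imp] at h1
            split_ifs at h1 with h2
            · exact (lt_or_ge _ _).imp_right fun h3 => le_trans h3 h2
            · exact .inr h1
          imp_intro := fun φ ψ hm hi => by
            refine ⟨hm, ?_⟩
            rw [h.imp]
            split_ifs
            · exact unitInterval.le_one'
            · exact hi.2
          coimp_elim := fun φ ψ hm hi => by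
            refine ⟨(hsub.coimp hm).1, ?_⟩
            have h1 := hi.2
            rw [h.coimp] at h1
            split_ifs at h1 with h2
            · exact absurd h1 (not_le.2 w.2)
            · exact h1
          coimp_intro := fun φ ψ hm hφ hψ => by
            refine ⟨hm, ?_⟩
            rw [h.coimp, if_neg]
            · exact hφ.2
            · exact fun hle => hψ ⟨(hsub.coimp hm).2, hφ.2.trans hle⟩ }
      antitone := fun k v w hvw ψ hψ => ⟨hψ.1, le_trans (show v.1 ≤ w.1 from hvw) hψ.2⟩
      imp := ?_
      coimp := ?_
      sensible := fun w k =>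
        { next := fun φ hm => by simp [hm, hsub.next hm, h.next, apply_zpow_apply]
          yest := fun φ hm => by simp [hm, hsub.yest hm, h.yest, inv_apply_zpow_apply]
          glob := fun φ hm => by
            simp only [Set.mem_ofPred_eq, hm, hsub.glob hm, true_and, le_isGLB_iff (h.glob _ _),
              mem_lowerBounds, Set.forall_mem_range, pow_apply_zpow_apply]
            exact forall_add_nat_iff (p := fun m => w.1 ≤ V φ ((S ^ m) t))
          hist := fun φ hm => by
            simp only [Set.mem_ofPred_eq, hm, hsub.hist hm, true_and, le_isGLB_iff (h.hist _ _),
              mem_lowerBounds, Set.forall_mem_range, inv_pow_apply_zpow_apply]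
            exact forall_sub_nat_iff (p := fun m => w.1 ≤ V φ ((S ^ m) t))
          untl := fun φ ψ hm => by
            have h1 := h.untl φ ψ ((S ^ k) t)
            have h2 := h.untl φ ψ ((S ^ (k + 1)) t)
            simp only [pow_apply_zpow_apply] at h1 h2
            have h3 := until_eq (a := fun n : ℕ => V φ ((S ^ (k + n)) t))
              (b := fun n : ℕ => V ψ ((S ^ (k + n)) t)) h1
              (by simpa only [Nat.cast_add, Nat.cast_one, add_assoc, add_comm (1 : ℤ)] using h2)
            simp [hm, hsub.untl hm, h3]
          snce := fun φ ψ hm => by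
            have h1 := h.snce φ ψ ((S ^ (k + 1)) t)
            have h2 := h.snce φ ψ ((S ^ k) t)
            simp only [inv_pow_apply_zpow_apply] at h1 h2
            have h3 := until_eq (a := fun n : ℕ => V φ ((S ^ (k + 1 - n)) t))
              (b := fun n : ℕ => V ψ ((S ^ (k + 1 - n)) t)) h1
              (by simpa only [Nat.cast_add, Nat.cast_one, add_sub_add_right_eq_sub] using h2)
            simp [hm, hsub.snce hm, h3] }
      glob := ?_
      hist := ?_
      untl := ?_
      snce := ?_ }
  · intro w k φ ψ hm
    have h1 : V (.imp φ ψ) ((S ^ k) t) < w.1 := not_le.1 fun hn => hm.2 ⟨hm.1, hn⟩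
    rw [h.imp] at h1
    split_ifs at h1 with h2
    · exact absurd h1 (not_lt.2 unitInterval.le_one')
    · have h3 := not_le.1 h2
      -- The minimum lies strictly above the value of `ψ`, since both of its arguments do.
      refine ⟨⟨min w.1 (V φ ((S ^ k) t)), lt_min w.2 (bot_le.trans_lt h3)⟩,
        Subtype.coe_le_coe.1 (min_le_left _ _),
        ⟨(hsub.imp hm.1).1, min_le_right _ _⟩, fun hn => ?_⟩
      exact absurd hn.2 (not_le.2 (lt_min h1 h3))
  · intro w k φ ψ hm
    have h1 := hm.2
    rw [h.coimp] at h1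
    split_ifs at h1 with h2
    · exact absurd h1 (not_le.2 w.2)
    · exact ⟨⟨V φ ((S ^ k) t), w.2.trans_le h1⟩, h1, ⟨(hsub.coimp hm.1).1, le_rfl⟩,
        fun hn => h2 hn.2⟩
  · intro w k φ hm
    have h1 : ¬ w.1 ≤ V (.glob φ) ((S ^ k) t) := fun hn => hm.2 ⟨hm.1, hn⟩
    simp only [le_isGLB_iff (h.glob _ _), mem_lowerBounds, Set.forall_mem_range,
      pow_apply_zpow_apply, not_forall] at h1
    obtain ⟨n, hn⟩ := h1
    exact ⟨w, rfl, n, fun hn' => hn hn'.2⟩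
  · intro w k φ hm
    have h1 : ¬ w.1 ≤ V (.hist φ) ((S ^ k) t) := fun hn => hm.2 ⟨hm.1, hn⟩
    simp only [le_isGLB_iff (h.hist _ _), mem_lowerBounds, Set.forall_mem_range,
      inv_pow_apply_zpow_apply, not_forall] at h1
    obtain ⟨n, hn⟩ := h1
    exact ⟨w, rfl, n, fun hn' => hn hn'.2⟩
  · intro w k φ ψ hm
    -- The supremum may be only approached at `w`; at the strictly smaller `v`, with the same
    -- current type, some term passes it.
    obtain ⟨v, hv, heq⟩ := gap w k
    obtain ⟨n, -, hn⟩ := (lt_until_iff (h.untl φ ψ _)).1 (lt_of_lt_of_le hv hm.2)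
    rw [pow_apply_zpow_apply] at hn
    exact ⟨v, heq, n, (hsub.untl hm.1).2, hn.le⟩
  · intro w k φ ψ hm
    obtain ⟨v, hv, heq⟩ := gap w k
    obtain ⟨n, -, hn⟩ := (lt_until_iff (h.snce φ ψ _)).1 (lt_of_lt_of_le hv hm.2)
    rw [inv_pow_apply_zpow_apply] at hn
    exact ⟨v, heq, n, (hsub.snce hm.1).2, hn.le⟩

end Real

/-! ### Pending and realised eventualities, treated uniformly. -/

section Eventualities

/-- `χ` is an eventuality about the future that `Φ` requires to be realised. -/
def FuturePending (Sig : Set Formula) : Formula → Set Formula → Prop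
  | .glob φ, Φ => .glob φ ∈ Sig \ Φ
  | .untl φ ψ, Φ => .untl φ ψ ∈ Φ
  | _, _ => False

/-- The eventuality `χ` about the future is realised in `Φ`. -/
def FutureRealised (Sig : Set Formula) : Formula → Set Formula → Prop
  | .glob φ, Φ => φ ∈ Sig \ Φ
  | .untl _ ψ, Φ => ψ ∈ Φ
  | _, _ => False

/-- `χ` is an eventuality about the past that `Φ` requires to be realised. -/
def PastPending (Sig : Set Formula) : Formula → Set Formula → Prop
  | .hist φ, Φ => .hist φ ∈ Sig \ Φ
  | .snce φ ψ, Φ => .snce φ ψ ∈ Φ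
  | _, _ => False

/-- The eventuality `χ` about the past is realised in `Φ`. -/
def PastRealised (Sig : Set Formula) : Formula → Set Formula → Prop
  | .hist φ, Φ => φ ∈ Sig \ Φ
  | .snce _ ψ, Φ => ψ ∈ Φ
  | _, _ => False

variable {Sig : Set Formula} {χ : Formula} {L : Type*} [LinearOrder L]
  {τ : L → ℤ → Set Formula} {w : L} {k : ℤ}

theorem IsTrace.future_step (h : IsTrace Sig τ) (hsub : SubformulaClosed Sig)
    (hP : FuturePending Sig χ (τ w k)) :
    FutureRealised Sig χ (τ w k) ∨ FuturePending Sig χ (τ w (k + 1)) := by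
  cases χ <;> try exact hP.elim
  case glob φ =>
    have h1 := (h.sensible w k).glob φ hP.1
    have h2 := hsub.glob hP.1
    have h3 := hP.2
    simp only [FutureRealised, FuturePending, Set.mem_sdiff]
    have h4 := hP.1
    tauto
  case untl φ ψ =>
    have h1 := (h.sensible w k).untl φ ψ ((h.isType w k).subset hP)
    exact (h1.1 hP).imp_right And.right

theorem IsTrace.past_step (h : IsTrace Sig τ) (hsub : SubformulaClosed Sig)
    (hP : PastPending Sig χ (τ w (k + 1))) :
    PastRealised Sig χ (τ w (k + 1)) ∨ PastPending Sig χ (τ w k) := by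
  cases χ <;> try exact hP.elim
  case hist φ =>
    have h1 := (h.sensible w k).hist φ hP.1
    have h2 := hsub.hist hP.1
    have h3 := hP.2
    simp only [PastRealised, PastPending, Set.mem_sdiff]
    have h4 := hP.1
    tauto
  case snce φ ψ =>
    have h1 := (h.sensible w k).snce φ ψ ((h.isType w (k + 1)).subset hP)
    exact (h1.1 hP).imp_right And.right

theorem IsTrace.future_realised (h : IsTrace Sig τ) (hsub : SubformulaClosed Sig)
    (hP : FuturePending Sig χ (τ w k)) :
    ∃ v, τ v k = τ w k ∧ ∃ n : ℕ, FutureRealised Sig χ (τ v (k + n)) := by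
  cases χ <;> try exact hP.elim
  case glob φ =>
    obtain ⟨v, hv, n, hn⟩ := h.glob w k φ hP
    exact ⟨v, hv, n, hsub.glob hP.1, hn⟩
  case untl φ ψ => exact h.untl w k φ ψ hP

theorem IsTrace.past_realised (h : IsTrace Sig τ) (hsub : SubformulaClosed Sig)
    (hP : PastPending Sig χ (τ w k)) :
    ∃ v, τ v k = τ w k ∧ ∃ n : ℕ, PastRealised Sig χ (τ v (k - n)) := by
  cases χ <;> try exact hP.elim
  case hist φ =>
    obtain ⟨v, hv, n, hn⟩ := h.hist w k φ hP
    exact ⟨v, hv, n, hsub.hist hP.1, hn⟩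
  case snce φ ψ => exact h.snce w k φ ψ hP

end Eventualities

/-! ### Choosing a loop and realising eventualities along it. -/

section Loop

variable {L : Type*} {Sig : Set Formula} {τ : L → ℤ → Set Formula}

/-- The set of types at some time `i` recurs `l` steps later, and all eventualities pending at
time `i` are realised within fewer than `l` steps. -/
theorem exists_loop (hfin : Sig.Finite) (hτ : ∀ w k, τ w k ⊆ Sig)
    {P Q : Formula → Set Formula → Prop}
    (hPQ : ∀ w k, ∀ χ ∈ Sig, P χ (τ w k) → ∃ v, τ v k = τ w k ∧ ∃ n : ℕ, Q χ (τ v (k + n))) :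
    ∃ i l : ℕ, 0 < i ∧ 0 < l ∧
      (Set.range fun w => τ w (i + l)) = (Set.range fun w => τ w i) ∧
      ∀ w, ∀ χ ∈ Sig, P χ (τ w i) → ∃ v, τ v i = τ w i ∧ ∃ n < l, Q χ (τ v (i + n)) := by
  -- The shift by one makes the start of the loop positive.
  let C : ℕ → Set (Set Formula) := fun n => Set.range fun w => τ w (n + 1 : ℕ)
  have hC : (Set.range C).Finite := by
    refine hfin.finite_subsets.finite_subsets.subset ?_
    rintro _ ⟨n, rfl⟩ _ ⟨w, rfl⟩
    exact hτ _ _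
  obtain ⟨c, hc⟩ : ∃ c, (C ⁻¹' {c}).Infinite := by
    by_contra! hfib
    exact Set.infinite_univ ((hC.biUnion fun c _ => hfib c).subset fun n _ =>
      Set.mem_biUnion (Set.mem_range_self n) rfl)
  obtain ⟨i, hi⟩ := hc.nonempty
  have hi' : C i = c := hi
  -- One bound serves all degrees, because only finitely many pairs of a type and an eventuality
  -- have to be considered.
  have hbound : ∃ N : ℕ, ∀ p ∈ c ×ˢ Sig, P p.2 p.1 →
      ∃ v, τ v (i + 1 : ℕ) = p.1 ∧ ∃ n < N, Q p.2 (τ v ((i + 1 : ℕ) + n)) := by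
    have hcfin : (c ×ˢ Sig).Finite := by
      refine Set.Finite.prod (hfin.finite_subsets.subset ?_) hfin
      rw [← hi']
      rintro _ ⟨w, rfl⟩
      exact hτ _ _
    have hN : ∀ p : Set Formula × Formula, ∃ N : ℕ, p ∈ c ×ˢ Sig → P p.2 p.1 →
        ∃ v, τ v (i + 1 : ℕ) = p.1 ∧ ∃ n < N, Q p.2 (τ v ((i + 1 : ℕ) + n)) := by
      rintro ⟨Φ, χ⟩
      by_cases hp : (Φ, χ) ∈ c ×ˢ Sig ∧ P χ Φ
      · obtain ⟨⟨hΦ, hχ⟩, hP⟩ := hp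
        simp only at hΦ hχ
        rw [← hi'] at hΦ
        obtain ⟨w, rfl⟩ := hΦ
        obtain ⟨v, hv, n, hn⟩ := hPQ w _ χ hχ hP
        exact ⟨n + 1, fun _ _ => ⟨v, hv, n, n.lt_succ_self, hn⟩⟩
      · exact ⟨0, fun h1 h2 => absurd ⟨h1, h2⟩ hp⟩
    choose N hN using hN
    obtain ⟨M, hM⟩ := (hcfin.image N).bddAbove
    refine ⟨M, fun p hp hP => ?_⟩
    obtain ⟨v, hv, n, hn, hQ⟩ := hN p hp hP
    exact ⟨v, hv, n, hn.trans_le (hM ⟨p, hp, rfl⟩), hQ⟩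
  obtain ⟨N, hN⟩ := hbound
  -- The recurrence is taken more than `N` steps later, so every realisation fits inside one turn of
  -- the loop.
  obtain ⟨j, hj, hij⟩ := hc.exists_gt (i + N)
  have hj' : C j = c := hj
  refine ⟨i + 1, j - i, by omega, by omega, ?_, fun w χ hχ hP => ?_⟩
  · have h1 : ((i + 1 : ℕ) : ℤ) + (j - i : ℕ) = (j + 1 : ℕ) := by omega
    rw [h1]
    exact hj'.trans hi'.symm
  · obtain ⟨v, hv, n, hn, hQ⟩ := hN (τ w (i + 1 : ℕ), χ) ⟨by rw [← hi']; exact ⟨w, rfl⟩, hχ⟩ hP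
    exact ⟨v, hv, n, by omega, hQ⟩

/-- A pending eventuality stays pending until it is realised. Successive edges may use different
degrees, so a realisation might be postponed forever; on reaching vertex `i`, one fixed degree is
followed instead. Using an abstract graph with a position function lets the past case be obtained by
reversal. -/
theorem reach_realised {X : Type*} {E : X → X → Prop} {pos : X → ℤ} {lab : X → Set Formula}
    {i l : ℕ} {P Q : Set Formula → Prop}
    (hX : ∀ x, pos x < i + l ∧ ∃ w, lab x = τ w (pos x))
    (step : ∀ x w, pos x + 1 < i + l → lab x = τ w (pos x) →
      ∃ y, E x y ∧ pos y = pos x + 1 ∧ lab y = τ w (pos x + 1))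
    (wrap : ∀ x w, pos x + 1 = i + l → lab x = τ w (pos x) →
      ∃ y, E x y ∧ pos y = i ∧ lab y = τ w (pos x + 1))
    (hP : ∀ w k, P (τ w k) → Q (τ w k) ∨ P (τ w (k + 1)))
    (loop : ∀ w, P (τ w i) → ∃ v, τ v i = τ w i ∧ ∃ n < l, Q (τ v (i + n)))
    (x : X) (hx : P (lab x)) : ∃ y, Relation.ReflTransGen E x y ∧ Q (lab y) := by
  -- A single degree is followed here, which is possible as long as the loop is not closed.
  have walk : ∀ (n : ℕ) x w, lab x = τ w (pos x) → pos x + n < i + l →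
      ∃ y, Relation.ReflTransGen E x y ∧ pos y = pos x + n ∧ lab y = τ w (pos x + n) := by
    intro n
    induction n with
    | zero => exact fun x w hl _ => ⟨x, .refl, by simp, by simpa using hl⟩
    | succ n ih =>
      intro x w hl hn
      push_cast at hn ⊢
      obtain ⟨y, hxy, hy, hly⟩ := ih x w hl (by omega)
      obtain ⟨z, hyz, hz, hlz⟩ := step y w (by omega) (by rw [hly, hy])
      refine ⟨z, hxy.tail hyz, by omega, ?_⟩
      rw [hlz, hy, add_assoc]
  have atLoop : ∀ x, pos x = i → P (lab x) → ∃ y, Relation.ReflTransGen E x y ∧ Q (lab y) := by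
    intro x hxi hx
    obtain ⟨w, hw⟩ := (hX x).2
    rw [hw, hxi] at hx
    obtain ⟨v, hv, n, hn, hQ⟩ := loop w hx
    obtain ⟨y, hxy, -, hly⟩ := walk n x v (by rw [hw, hxi, hv]) (by omega)
    exact ⟨y, hxy, by rwa [hly, hxi]⟩
  -- Induction on the distance to the last vertex of the loop, whose edge leads to `i`.
  obtain ⟨d, hd⟩ : ∃ d : ℕ, pos x + d + 1 = i + l :=
    ⟨(i + l - 1 - pos x).toNat, by have := (hX x).1; omega⟩
  induction d generalizing x with
  | zero =>
    obtain ⟨w, hw⟩ := (hX x).2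
    rw [hw] at hx
    rcases hP w _ hx with h | h
    · exact ⟨x, .refl, hw ▸ h⟩
    · obtain ⟨y, hxy, hy, hly⟩ := wrap x w (by simpa using hd) hw
      obtain ⟨z, hyz, hz⟩ := atLoop y hy (by rwa [hly])
      exact ⟨z, .head hxy hyz, hz⟩
  | succ d ih =>
    obtain ⟨w, hw⟩ := (hX x).2
    rw [hw] at hx
    rcases hP w _ hx with h | h
    · exact ⟨x, .refl, hw ▸ h⟩
    · obtain ⟨y, hxy, hy, hly⟩ := step x w (by push_cast at hd; omega) hw
      obtain ⟨z, hyz, hz⟩ := ih y (by rwa [hly]) (by push_cast at hd; omega)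
      exact ⟨z, .head hxy hyz, hz⟩

end Loop

/-! ### Pairs of antitone maps on a linear order. -/

section Coupling

variable {L : Type*} [LinearOrder L] {f g : L → Set Formula}

/-- If `v` and `w` are ordered against the inclusion, antitonicity forces `f v = f w`, and either
degree can stand for the other. With `coupling_up`, and with `f` and `g` exchanged, this covers all
four confluence conditions. -/
theorem coupling_down (hf : Antitone f) (hg : Antitone g) {v w : L} (h : f w ⊆ f v) :
    ∃ u, f u = f v ∧ g w ⊆ g u := by
  rcases le_total v w with hvw | hvw
  · exact ⟨v, rfl, hg hvw⟩
  · exact ⟨w, h.antisymm (hf hvw), subset_rfl⟩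

theorem coupling_up (hf : Antitone f) (hg : Antitone g) {v w : L} (h : f w ⊆ f v) :
    ∃ u, f u = f w ∧ g u ⊆ g v := by
  rcases le_total v w with hvw | hvw
  · exact ⟨w, rfl, hg hvw⟩
  · exact ⟨v, (h.antisymm (hf hvw)).symm, subset_rfl⟩

/-- Either `v` lies between `u` and `w`, where `f` is constant, or it lies outside and `g v` agrees
with `g` at the nearer endpoint. -/
theorem coupling_convex (hf : Antitone f) (hg : Antitone g) {u v w : L} (h : f u = f w)
    (huv : g v ⊆ g u) (hvw : g w ⊆ g v) : ∃ z, f z = f u ∧ g z = g v := by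
  rcases le_total u v with h1 | h1
  · rcases le_total v w with h2 | h2
    · exact ⟨v, (hf h1).antisymm (h.trans_le (hf h2)), rfl⟩
    · exact ⟨w, h.symm, hvw.antisymm (hg h2)⟩
  · exact ⟨u, rfl, (hg h1).antisymm huv⟩

end Coupling

/-! ### Folding a trace to a double lasso. -/

/-- A point of the double lasso obtained by folding the trace `τ`: a vertex together with one of
the types that occur in `τ` at that time. -/
@[ext]
structure LassoPoint {L : Type*} (τ : L → ℤ → Set Formula) (i' l' i l : ℕ) : Type where
  /-- the vertex -/
  pos : ℤ
  /-- the type -/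
  lab : Set Formula
  pos_mem : pos ∈ lassoVertices i' l' i l
  lab_mem : lab ∈ Set.range fun w => τ w pos

namespace LassoPoint

variable {L : Type*} {τ : L → ℤ → Set Formula} {i' l' i l : ℕ}

instance : PartialOrder (LassoPoint τ i' l' i l) where
  le x y := x.pos = y.pos ∧ y.lab ⊆ x.lab
  le_refl x := ⟨rfl, subset_rfl⟩
  le_trans x y z hxy hyz := ⟨hxy.1.trans hyz.1, hyz.2.trans hxy.2⟩
  le_antisymm x y hxy hyx := LassoPoint.ext hxy.1 (hyx.2.antisymm hxy.2)

theorem le_def {x y : LassoPoint τ i' l' i l} : x ≤ y ↔ x.pos = y.pos ∧ y.lab ⊆ x.lab := Iff.rfl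

/-- The vertex from which the edge starts that represents the step from time `k` to `k + 1`. -/
def source (i' l' : ℕ) (k : ℤ) : ℤ := if k = -((i' : ℤ) + l') then -(i' : ℤ) else k

/-- The vertex at which the edge ends that represents the step from time `k - 1` to `k`. -/
def target (i l : ℕ) (k : ℤ) : ℤ := if k = (i : ℤ) + l then (i : ℤ) else k

/-- Two points are related if some truth degree has these types at consecutive times. -/
def Rel (x y : LassoPoint τ i' l' i l) : Prop :=
  -- Both extreme values of `k` stand for the edges closing the loops: the lowest for the past loop,
  -- the highest for the future one.
  ∃ k : ℤ, -((i' : ℤ) + l') ≤ k ∧ k < (i : ℤ) + l ∧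
    x.pos = source i' l' k ∧ y.pos = target i l (k + 1) ∧
    ∃ w, x.lab = τ w k ∧ y.lab = τ w (k + 1)

/-- Along a strict chain the labels are strictly decreasing subsets of `Sig`, so their cardinalities
are distinct numbers between `0` and `Sig.ncard`. -/
theorem height_le {Sig : Set Formula} (hfin : Sig.Finite) (hτ : ∀ w k, τ w k ⊆ Sig) :
    height (LassoPoint τ i' l' i l) ≤ (Sig.ncard : ℕ∞) + 1 := by
  have hx : ∀ x : LassoPoint τ i' l' i l, x.lab ⊆ Sig := fun x => by
    obtain ⟨w, hw⟩ := x.lab_mem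
    exact hw ▸ hτ _ _
  refine iSup₂_le ?_
  rintro n ⟨c, hc⟩
  have hanti : StrictAnti fun a => (c a).lab.ncard := by
    intro a b hab
    have hlt := hc hab
    refine Set.ncard_lt_ncard (hlt.le.2.ssubset_of_ne fun heq => hlt.ne ?_) (hfin.subset (hx _))
    exact LassoPoint.ext hlt.le.1 heq.symm
  have hcard := Fintype.card_le_of_injective
    (fun a : Fin n => (⟨(c a).lab.ncard, Nat.lt_succ_of_le (Set.ncard_le_ncard (hx _) hfin)⟩ :
      Fin (Sig.ncard + 1)))
    fun a b hab => hanti.injective (by simpa using hab)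
  simp only [Fintype.card_fin] at hcard
  exact_mod_cast hcard

end LassoPoint

section Lasso

open LassoPoint

variable {L : Type*} {τ : L → ℤ → Set Formula} {i' l' i l : ℕ}

/-- The loop parameters `i' l' i l` are positive and `τ` has the same types at both ends of each
loop, so that it can be folded to a double lasso. -/
structure Foldable (τ : L → ℤ → Set Formula) (i' l' i l : ℕ) : Prop where
  past_start : 0 < i'
  past_length : 0 < l'
  future_start : 0 < i
  future_length : 0 < l
  past_range : (Set.range fun w => τ w (-((i' : ℤ) + l'))) = Set.range fun w => τ w (-(i' : ℤ))
  future_range : (Set.range fun w => τ w ((i : ℤ) + l)) = Set.range fun w => τ w (i : ℤ)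

namespace Foldable

variable {k m : ℤ}

theorem source_mem (F : Foldable τ i' l' i l) (h₁ : -((i' : ℤ) + l') ≤ k)
    (h₂ : k < (i : ℤ) + l) : source i' l' k ∈ lassoVertices i' l' i l := by
  obtain ⟨hi', hl', hi, hl, -, -⟩ := F
  unfold source lassoVertices
  rw [Set.mem_Icc]
  split_ifs <;> omega

theorem target_mem (F : Foldable τ i' l' i l) (h₁ : -((i' : ℤ) + l') ≤ k)
    (h₂ : k < (i : ℤ) + l) : target i l (k + 1) ∈ lassoVertices i' l' i l := by
  obtain ⟨hi', hl', hi, hl, -, -⟩ := F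
  unfold target lassoVertices
  rw [Set.mem_Icc]
  split_ifs <;> omega

/-- Needed for convexity: related pairs over the same edge come from the same time step, hence from
the same pair of antitone maps. -/
theorem step_unique (F : Foldable τ i' l' i l) (hs : source i' l' k = source i' l' m)
    (ht : target i l (k + 1) = target i l (m + 1)) : k = m := by
  obtain ⟨hi', hl', hi, hl, -, -⟩ := F
  unfold source at hs
  unfold target at ht
  split_ifs at hs ht <;> omega

theorem lassoEdge (F : Foldable τ i' l' i l) {x y : LassoPoint τ i' l' i l} (h : Rel x y) :
    LassoEdge i' l' i l x.pos y.pos := by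
  obtain ⟨hi', hl', hi, hl, -, -⟩ := F
  obtain ⟨k, hk₁, hk₂, hx, hy, -⟩ := h
  unfold source at hx
  unfold target at hy
  unfold LassoEdge
  split_ifs at hx hy <;> omega

theorem range_source (F : Foldable τ i' l' i l) (k : ℤ) :
    (Set.range fun w => τ w (source i' l' k)) = Set.range fun w => τ w k := by
  unfold source
  split_ifs with h
  · rw [h, F.past_range]
  · rfl

theorem range_target (F : Foldable τ i' l' i l) (k : ℤ) :
    (Set.range fun w => τ w (target i l k)) = Set.range fun w => τ w k := by
  unfold target
  split_ifs with h
  · rw [h, F.future_range]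
  · rfl

theorem exists_rel_of_source (F : Foldable τ i' l' i l) (h₁ : -((i' : ℤ) + l') ≤ k)
    (h₂ : k < (i : ℤ) + l) {x : LassoPoint τ i' l' i l} (hx : x.pos = source i' l' k) {w : L}
    (hw : x.lab = τ w k) :
    ∃ y : LassoPoint τ i' l' i l,
      Rel x y ∧ y.pos = target i l (k + 1) ∧ y.lab = τ w (k + 1) :=
  ⟨⟨target i l (k + 1), τ w (k + 1), F.target_mem h₁ h₂, by
    rw [F.range_target]; exact ⟨w, rfl⟩⟩, ⟨k, h₁, h₂, hx, rfl, w, hw, rfl⟩, rfl, rfl⟩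

theorem exists_rel_of_target (F : Foldable τ i' l' i l) (h₁ : -((i' : ℤ) + l') ≤ k)
    (h₂ : k < (i : ℤ) + l) {y : LassoPoint τ i' l' i l} (hy : y.pos = target i l (k + 1)) {w : L}
    (hw : y.lab = τ w (k + 1)) :
    ∃ x : LassoPoint τ i' l' i l, Rel x y ∧ x.pos = source i' l' k ∧ x.lab = τ w k :=
  ⟨⟨source i' l' k, τ w k, F.source_mem h₁ h₂, by
    rw [F.range_source]; exact ⟨w, rfl⟩⟩, ⟨k, h₁, h₂, rfl, hy, w, rfl, hw⟩, rfl, rfl⟩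

/-- At the edge closing the past loop, the degree that gives `x` its label at its own vertex need
not give it at time `k`; equality of the sets of types supplies another degree. -/
theorem exists_lab_of_source (F : Foldable τ i' l' i l) {x : LassoPoint τ i' l' i l}
    (hx : x.pos = source i' l' k) : ∃ w, x.lab = τ w k := by
  have h := x.lab_mem
  rw [hx, F.range_source] at h
  exact h.imp fun w hw => hw.symm

theorem exists_lab_of_target (F : Foldable τ i' l' i l) {x : LassoPoint τ i' l' i l}
    (hx : x.pos = target i l k) : ∃ w, x.lab = τ w k := by
  have h := x.lab_mem
  rw [hx, F.range_target] at h
  exact h.imp fun w hw => hw.symm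

theorem forth (F : Foldable τ i' l' i l) (x : LassoPoint τ i' l' i l) (w : L)
    (hw : x.lab = τ w x.pos) :
    ∃ y : LassoPoint τ i' l' i l,
      Rel x y ∧ y.pos = target i l (x.pos + 1) ∧ y.lab = τ w (x.pos + 1) := by
  have hm := x.pos_mem
  unfold lassoVertices at hm
  rw [Set.mem_Icc] at hm
  exact F.exists_rel_of_source (by omega) (by omega) (by unfold source; split_ifs <;> omega) hw

theorem back (F : Foldable τ i' l' i l) (y : LassoPoint τ i' l' i l) (w : L)
    (hw : y.lab = τ w y.pos) :
    ∃ x : LassoPoint τ i' l' i l,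
      Rel x y ∧ x.pos = source i' l' (y.pos - 1) ∧ x.lab = τ w (y.pos - 1) := by
  have hm := y.pos_mem
  unfold lassoVertices at hm
  rw [Set.mem_Icc] at hm
  exact F.exists_rel_of_target (by omega) (by omega) (by unfold target; split_ifs <;> omega)
    (by rw [hw, sub_add_cancel])

end Foldable

variable [LinearOrder L] {Sig : Set Formula}

theorem IsTrace.le_total (h : IsTrace Sig τ) {x y : LassoPoint τ i' l' i l}
    (hxy : x.pos = y.pos) : x ≤ y ∨ y ≤ x := by
  obtain ⟨v, hv⟩ := x.lab_mem
  obtain ⟨w, hw⟩ := y.lab_mem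
  simp only at hv hw
  simp only [LassoPoint.le_def, hxy, ← hv, ← hw, true_and]
  exact (_root_.le_total v w).imp (fun h1 => h.antitone _ h1) (fun h1 => h.antitone _ h1)

theorem IsTrace.isLabelledSpace (h : IsTrace Sig τ) :
    IsLabelledSpace Sig (LassoPoint.lab : LassoPoint τ i' l' i l → Set Formula) where
  locallyLinear := ⟨Setoid.ker LassoPoint.pos, fun x y =>
    ⟨fun hxy => h.le_total hxy, fun hxy => hxy.elim (fun h1 => h1.1) fun h1 => h1.1.symm⟩⟩
  isType x := by
    obtain ⟨w, hw⟩ := x.lab_mem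
    exact hw ▸ h.isType _ _
  antitone x y hxy := hxy.2
  imp x φ ψ hm := by
    obtain ⟨w, hw⟩ := x.lab_mem
    rw [← hw] at hm
    obtain ⟨v, hv, hvm⟩ := h.imp _ _ _ _ hm
    exact ⟨⟨x.pos, τ v x.pos, x.pos_mem, v, rfl⟩, ⟨rfl, hw ▸ h.antitone _ hv⟩, hvm⟩
  coimp x φ ψ hm := by
    obtain ⟨w, hw⟩ := x.lab_mem
    rw [← hw] at hm
    obtain ⟨v, hv, hvm⟩ := h.coimp _ _ _ _ hm
    exact ⟨⟨x.pos, τ v x.pos, x.pos_mem, v, rfl⟩, ⟨rfl, hw ▸ h.antitone _ hv⟩, hvm⟩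

/-! ### The folded system as an ultimately periodic quasimodel. -/

namespace Foldable

theorem fullyConfluent (F : Foldable τ i' l' i l) (h : IsTrace Sig τ) :
    FullyConfluent (Rel : LassoPoint τ i' l' i l → LassoPoint τ i' l' i l → Prop) where
  forth_down := by
    rintro x x' y' ⟨hp, hl⟩ ⟨k, h₁, h₂, hx, hy, w, hxw, hyw⟩
    obtain ⟨v, hv⟩ := F.exists_lab_of_source (hp.trans hx)
    obtain ⟨u, hu, hg⟩ := coupling_down (h.antitone k) (h.antitone (k + 1))
      (v := v) (w := w) (hv ▸ hxw ▸ hl)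
    obtain ⟨y, hxy, hy', hyl⟩ := F.exists_rel_of_source h₁ h₂ (hp.trans hx) (hv.trans hu.symm)
    exact ⟨y, hxy, hy'.trans hy.symm, by rw [hyl, hyw]; exact hg⟩
  forth_up := by
    rintro x x' y ⟨hp, hl⟩ ⟨k, h₁, h₂, hx, hy, w, hxw, hyw⟩
    obtain ⟨v, hv⟩ := F.exists_lab_of_source (hp.symm.trans hx)
    obtain ⟨u, hu, hg⟩ := coupling_up (h.antitone k) (h.antitone (k + 1))
      (v := w) (w := v) (hv ▸ hxw ▸ hl)
    obtain ⟨y', hxy, hy', hyl⟩ := F.exists_rel_of_source h₁ h₂ (hp.symm.trans hx)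
      (hv.trans hu.symm)
    exact ⟨y', hxy, hy.trans hy'.symm, by rw [hyl, hyw]; exact hg⟩
  back_down := by
    rintro x' y y' ⟨k, h₁, h₂, hx, hy, w, hxw, hyw⟩ ⟨hp, hl⟩
    obtain ⟨v, hv⟩ := F.exists_lab_of_target (hp.trans hy)
    obtain ⟨u, hu, hg⟩ := coupling_down (h.antitone (k + 1)) (h.antitone k)
      (v := v) (w := w) (hv ▸ hyw ▸ hl)
    obtain ⟨x, hxy, hx', hxl⟩ := F.exists_rel_of_target h₁ h₂ (hp.trans hy) (hv.trans hu.symm)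
    exact ⟨x, ⟨hx'.trans hx.symm, by rw [hxl, hxw]; exact hg⟩, hxy⟩
  back_up := by
    rintro x y y' ⟨k, h₁, h₂, hx, hy, w, hxw, hyw⟩ ⟨hp, hl⟩
    obtain ⟨v, hv⟩ := F.exists_lab_of_target (hp.symm.trans hy)
    obtain ⟨u, hu, hg⟩ := coupling_up (h.antitone (k + 1)) (h.antitone k)
      (v := w) (w := v) (hv ▸ hyw ▸ hl)
    obtain ⟨x', hxy, hx', hxl⟩ := F.exists_rel_of_target h₁ h₂ (hp.symm.trans hy)
      (hv.trans hu.symm)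
    exact ⟨x', ⟨hx.trans hx'.symm, by rw [hxl, hxw]; exact hg⟩, hxy⟩

theorem convexRel (F : Foldable τ i' l' i l) (h : IsTrace Sig τ) :
    ConvexRel (Rel : LassoPoint τ i' l' i l → LassoPoint τ i' l' i l → Prop) := by
  constructor
  · refine fun x => ⟨?_⟩
    rintro y₁ ⟨k, h₁, h₂, hx, hy, w, hxw, hyw⟩ y₂ ⟨m, -, -, hx', hy', w', hxw', hyw'⟩ y
      ⟨⟨hp₁, hl₁⟩, ⟨hp₂, hl₂⟩⟩
    obtain rfl := F.step_unique (hx ▸ hx')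
      (by rw [← hy, ← hy', hp₁, hp₂])
    obtain ⟨v, hv⟩ := F.exists_lab_of_target (hp₁.symm.trans hy)
    obtain ⟨z, hz, hz'⟩ := coupling_convex (h.antitone k) (h.antitone (k + 1))
      (u := w) (v := v) (w := w') (hxw ▸ hxw') (hyw ▸ hv ▸ hl₁) (hyw' ▸ hv ▸ hl₂)
    exact ⟨k, h₁, h₂, hx, hp₁.symm.trans hy, z, hxw.trans hz.symm, hv.trans hz'.symm⟩
  · refine fun y => ⟨?_⟩
    rintro x₁ ⟨k, h₁, h₂, hx, hy, w, hxw, hyw⟩ x₂ ⟨m, -, -, hx', hy', w', hxw', hyw'⟩ x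
      ⟨⟨hp₁, hl₁⟩, ⟨hp₂, hl₂⟩⟩
    obtain rfl := F.step_unique (by rw [← hx, ← hx', hp₁, hp₂]) (hy ▸ hy')
    obtain ⟨v, hv⟩ := F.exists_lab_of_source (hp₁.symm.trans hx)
    obtain ⟨z, hz, hz'⟩ := coupling_convex (h.antitone (k + 1)) (h.antitone k)
      (u := w) (v := v) (w := w') (hyw ▸ hyw') (hxw ▸ hv ▸ hl₁) (hxw' ▸ hv ▸ hl₂)
    exact ⟨k, h₁, h₂, hp₁.symm.trans hx, hy, z, hv.trans hz'.symm, hyw.trans hz.symm⟩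

theorem isLabelledSystem (F : Foldable τ i' l' i l) (h : IsTrace Sig τ) :
    IsLabelledSystem Sig (LassoPoint.lab : LassoPoint τ i' l' i l → Set Formula) Rel where
  toIsLabelledSpace := h.isLabelledSpace
  serial x := by
    obtain ⟨w, hw⟩ := x.lab_mem
    obtain ⟨y, hy, -⟩ := F.forth x w hw.symm
    exact ⟨y, hy⟩
  serial_back y := by
    obtain ⟨w, hw⟩ := y.lab_mem
    obtain ⟨x, hx, -⟩ := F.back y w hw.symm
    exact ⟨x, hx⟩
  confluent := F.fullyConfluent h
  convex := F.convexRel h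
  sensible := by
    rintro x y ⟨k, -, -, -, -, w, hx, hy⟩
    exact hx ▸ hy ▸ h.sensible w k

theorem ultimatelyPeriodic [Nonempty L] (F : Foldable τ i' l' i l) (h : IsTrace Sig τ) :
    UltimatelyPeriodic (Rel : LassoPoint τ i' l' i l → LassoPoint τ i' l' i l → Prop) := by
  refine ⟨i', l', i, l, F.past_start, F.past_length, F.future_start, F.future_length,
    LassoPoint.pos, fun x => x.pos_mem, fun t ht => ?_, fun x y hxy => F.lassoEdge hxy⟩
  -- A degree is needed so that no fibre is empty.
  obtain ⟨w⟩ := ‹Nonempty L›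
  refine ⟨⟨t, τ w t, ht, w, rfl⟩, Set.ext fun x => ⟨fun hx => h.le_total ?_, ?_⟩⟩
  · exact (Set.mem_singleton_iff.1 hx).symm
  · exact fun hx => hx.elim (fun h1 => h1.1.symm) fun h1 => h1.1

theorem future_reach (F : Foldable τ i' l' i l) (h : IsTrace Sig τ) (hsub : SubformulaClosed Sig)
    {χ : Formula}
    (loop : ∀ w, FuturePending Sig χ (τ w i) →
      ∃ v, τ v i = τ w i ∧ ∃ n < l, FutureRealised Sig χ (τ v (i + n)))
    (x : LassoPoint τ i' l' i l) (hx : FuturePending Sig χ x.lab) :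
    ∃ y, Relation.ReflTransGen Rel x y ∧ FutureRealised Sig χ y.lab := by
  refine reach_realised (τ := τ) (i := i) (l := l) (pos := LassoPoint.pos) (fun x => ⟨?_, ?_⟩)
    (fun x w hlt hw => ?_) (fun x w heq hw => ?_) (fun w k => h.future_step hsub) loop x hx
  · have hm := x.pos_mem.2
    omega
  · exact x.lab_mem.imp fun w hw => hw.symm
  · obtain ⟨y, hxy, hp, hl⟩ := F.forth x w hw
    exact ⟨y, hxy, by rw [hp, target, if_neg (by omega)], hl⟩
  · obtain ⟨y, hxy, hp, hl⟩ := F.forth x w hw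
    exact ⟨y, hxy, by rw [hp, target, if_pos heq], hl⟩

theorem past_reach (F : Foldable τ i' l' i l) (h : IsTrace Sig τ) (hsub : SubformulaClosed Sig)
    {χ : Formula}
    (loop : ∀ w, PastPending Sig χ (τ w (-(i' : ℤ))) →
      ∃ v, τ v (-(i' : ℤ)) = τ w (-(i' : ℤ)) ∧ ∃ n < l', PastRealised Sig χ (τ v (-(i' + n : ℤ))))
    (x : LassoPoint τ i' l' i l) (hx : PastPending Sig χ x.lab) :
    ∃ y, Relation.ReflTransGen Rel y x ∧ PastRealised Sig χ y.lab := by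
  suffices ∃ y, Relation.ReflTransGen (Function.swap Rel) x y ∧ PastRealised Sig χ y.lab by
    simpa only [Relation.reflTransGen_swap] using this
  -- Reversing time, positions and edges makes the past loop a future loop starting at `i'`.
  refine reach_realised (τ := fun w k => τ w (-k)) (i := i') (l := l')
    (pos := fun x : LassoPoint τ i' l' i l => -x.pos) (fun x => ⟨?_, ?_⟩)
    (fun x w hlt hw => ?_) (fun x w heq hw => ?_) (fun w k hP => ?_) loop x hx
  · have hm := x.pos_mem.1
    omega
  · simp only [neg_neg]
    exact x.lab_mem.imp fun w hw => hw.symm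
  · simp only [neg_neg] at hw
    obtain ⟨y, hxy, hp, hl⟩ := F.back x w hw
    refine ⟨y, hxy, ?_, ?_⟩
    · rw [hp, source, if_neg (by omega)]
      ring
    · rw [hl]
      congr 1
      ring
  · simp only [neg_neg] at hw
    obtain ⟨y, hxy, hp, hl⟩ := F.back x w hw
    refine ⟨y, hxy, ?_, ?_⟩
    · rw [hp, source, if_pos (by omega), neg_neg]
    · rw [hl]
      congr 1
      ring
  · have hk : -k = -(k + 1) + 1 := by ring
    rw [hk] at hP ⊢
    exact h.past_step hsub hP

end Foldable

end Lasso

/-- Every trace over a finite set of formulas folds to an ultimately periodic quasimodel. -/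
theorem IsTrace.exists_quasimodel {L : Type*} [LinearOrder L] {τ : L → ℤ → Set Formula}
    {Sig : Set Formula} (h : IsTrace Sig τ) (hfin : Sig.Finite) (hsub : SubformulaClosed Sig)
    {φ : Formula} (hφ : φ ∈ Sig) {w : L} (hw : φ ∉ τ w 0) :
    ∃ (W : Type) (_ : PartialOrder W) (l : W → Set Formula) (R : W → W → Prop),
      IsQuasimodel Sig l R ∧ UltimatelyPeriodic R ∧
      height W ≤ (Sig.ncard : ℕ∞) + 1 ∧ Falsifies Sig l φ := by
  have hτ : ∀ w k, τ w k ⊆ Sig := fun w k => (h.isType w k).subset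
  obtain ⟨i, l, hi, hl, hC, hloop⟩ := exists_loop hfin hτ
    (P := FuturePending Sig) (Q := FutureRealised Sig) fun w k χ _ => h.future_realised hsub
  obtain ⟨i', l', hi', hl', hC', hloop'⟩ := exists_loop (τ := fun w k => τ w (-k)) hfin
    (fun w k => hτ w (-k)) (P := PastPending Sig) (Q := PastRealised Sig) fun w k χ _ hP => by
      obtain ⟨v, hv, n, hn⟩ := h.past_realised hsub hP
      exact ⟨v, hv, n, by rwa [neg_add, ← sub_eq_add_neg]⟩
  have F : Foldable τ i' l' i l := ⟨hi', hl', hi, hl, hC', hC⟩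
  have : Nonempty L := ⟨w⟩
  have hmem : ∀ (x : LassoPoint τ i' l' i l) χ, χ ∈ x.lab → χ ∈ Sig := fun x χ hχ =>
    (h.isLabelledSpace.isType x).subset hχ
  refine ⟨LassoPoint τ i' l' i l, inferInstance, LassoPoint.lab, LassoPoint.Rel,
    { toIsLabelledSystem := F.isLabelledSystem h
      omega :=
        { glob := fun x ψ hx => F.future_reach h hsub (χ := .glob ψ)
            (fun w => hloop w _ hx.1) x hx
          hist := fun x ψ hx => F.past_reach h hsub (χ := .hist ψ)
            (fun w => hloop' w _ hx.1) x hx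
          untl := fun x ψ θ hx => F.future_reach h hsub (χ := .untl ψ θ)
            (fun w => hloop w _ (hmem x _ hx)) x hx
          snce := fun x ψ θ hx => F.past_reach h hsub (χ := .snce ψ θ)
            (fun w => hloop' w _ (hmem x _ hx)) x hx } },
    F.ultimatelyPeriodic h, LassoPoint.height_le hfin hτ, ⟨0, τ w 0, ?_, w, rfl⟩, hφ, hw⟩
  unfold lassoVertices
  rw [Set.mem_Icc]
  omega

end GTL

theorem mainTheorem6 (Sig : Set GTL.Formula) (hfin : Sig.Finite)
    (hsub : GTL.SubformulaClosed Sig) (φ : GTL.Formula) (hφ : φ ∈ Sig)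
    (hfals : ¬ GTL.RealValid.{u} φ ∨ ¬ GTL.BiRelValid.{v, w} φ) :
    ∃ (W : Type) (_ : PartialOrder W) (l : W → Set GTL.Formula) (R : W → W → Prop),
      GTL.IsQuasimodel Sig l R ∧ GTL.UltimatelyPeriodic R ∧
      GTL.height W ≤ (Sig.ncard : ℕ∞) + 1 ∧ GTL.Falsifies Sig l φ := by
  rcases hfals with hfals | hfals
  · unfold GTL.RealValid at hfals
    push Not at hfals
    obtain ⟨T, S, V, hV, t, ht⟩ := hfals
    -- The degree `1` detects falsification: its type contains exactly the formulas of `Sig` with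
    -- value `1`.
    refine (hV.isTrace hfin hsub t).exists_quasimodel hfin hsub hφ (w := ⟨1, zero_lt_one⟩) ?_
    exact fun hm => ht (le_antisymm unitInterval.le_one' (by simpa using hm.2))
  · unfold GTL.BiRelValid at hfals
    push Not at hfals
    obtain ⟨W, T, _, S, val, hval, hne⟩ := hfals
    obtain ⟨⟨w, t⟩, hwt⟩ := (Set.ne_univ_iff_exists_notMem _).1 hne
    exact (hval.isTrace hsub t).exists_quasimodel hfin hsub hφ (w := w) fun hm => hwt hm.2
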